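/- Let $(\Omega,\mathcal F,\mathbb P)$ be a nonatomic probability space. Let $\delta:[0,1]\to[0,1]$ be a concave, increasing function with $\delta(0)=0$ and $\delta(1)=1$ that is continuous at $0$. For $X\in L^\infty$ with distribution function $F_X$ put $$\rho_\delta(X)=\int_{-\infty}^0\delta(F_X(x))\,dx-\int_0^\infty\bigl(1-\delta(F_X(x))\bigr)\,dx,\qquad \mathcal A_\delta=\{X\in L^\infty:\rho_\delta(X)\le 0\}.$$ Let $S=(S_0,S_T)$ be a traded asset, that is, $S_0>0$ and $0\ne S_T\in L^\infty_+$, and assume that the risk measure $$\rho_{\mathcal A_\delta,S}(X)=\inf\Bigl\{m\in\mathbb R: X+\tfrac{m}{S_0}S_T\in\mathcal A_\delta\Bigr\}$$ is finite for every $X\in L^\infty$. The index of finiteness of $\rho_{\mathcal A_\delta,S}$ is $$\inf\{p\in[1,\infty): \text{the closure of }\mathcal A_\delta\text{ in }L^p\text{ has nonempty interior in }L^p\}\in[1,\infty]$$ (with $\inf\emptyset=\infty$); it is said to be attained if it belongs to this set of exponents. Let $\delta'_+$ be the right derivative of $\delta$ on $(0,1)$, and $$q=\sup\Bigl\{p\in[1,\infty):\int_0^1(\delta'_+(\lambda))^p\,d\lambda<\infty\Bigr\}\in[1,\infty].$$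 Then the index of finiteness of $\rho_{\mathcal A_\delta,S}$ equals the conjugate exponent $q'=\frac{q}{q-1}$ (with $1'=\infty$ and $\infty'=1$). It is attained if and only if $q>1$ and $\int_0^1(\delta'_+(\lambda))^q\,d\lambda<\infty$, where for $q=\infty$ the last condition means that $\delta'_+$ is bounded on $(0,1)$. -/

import Mathlib

open MeasureTheory Set
open scoped ENNReal

noncomputable section

namespace DistortionRisk

/-- `P` is nonatomic: every event of positive probability contains an event of positive and
strictly smaller probability. (Mathlib's `NoAtoms` only says that singletons are null.) -/
def Nonatomic {Ω : Type*} [MeasurableSpace Ω] (P : Measure Ω) : Prop :=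
  ∀ s : Set Ω, MeasurableSet s → 0 < P s → ∃ t ⊆ s, MeasurableSet t ∧ 0 < P t ∧ P t < P s

/-- A traded asset `S = (S₀, S_T)`: a price `S₀ > 0` and a nonzero payoff `S_T ∈ L^∞_+`. -/
structure TradedAsset {Ω : Type*} [MeasurableSpace Ω] (P : Measure Ω) where
  price : ℝ
  payoff : Lp ℝ ∞ P
  price_pos : 0 < price
  payoff_nonneg : 0 ≤ payoff
  payoff_ne_zero : payoff ≠ 0

/-- The risk measure `ρ_{A,S}(X) = inf {m ∈ ℝ | X + (m / S₀) S_T ∈ A}`, with values in the extended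
real line. -/
def riskMeasure {Ω : Type*} [MeasurableSpace Ω] {P : Measure Ω} (A : Set (Lp ℝ ∞ P))
    (S : TradedAsset P) (X : Lp ℝ ∞ P) : EReal :=
  sInf ((fun m : ℝ => (m : EReal)) '' {m : ℝ | X + (m / S.price) • S.payoff ∈ A})

/-- A concave distortion function, as a function on `ℝ` of which only the values on `[0,1]` matter.
Its values on `[0,1]` lie in `[0,1]` by monotonicity, and it is continuous on `(0,1]` by concavity
and monotonicity, so that continuity at `0` amounts to continuity. -/
structure IsConcaveDistortion (δ : ℝ → ℝ) : Prop where
  concave : ConcaveOn ℝ (Icc 0 1) δ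
  increasing : MonotoneOn δ (Icc 0 1)
  map_zero : δ 0 = 0
  map_one : δ 1 = 1
  continuous_zero : ContinuousWithinAt δ (Icc 0 1) 0

/-- The distribution function `F_X(x) = P(X ≤ x)`. -/
def distFun {Ω : Type*} [MeasurableSpace Ω] {P : Measure Ω} (X : Lp ℝ ∞ P) (x : ℝ) : ℝ :=
  P.real {ω | X ω ≤ x}

/-- The distortion risk measure
`ρ_δ(X) = ∫_{-∞}^0 δ(F_X(x)) dx - ∫_0^∞ (1 - δ(F_X(x))) dx` on `L^∞`. Both integrands are bounded
and vanish outside a bounded interval, because `X` is bounded. -/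
def distortionRisk {Ω : Type*} [MeasurableSpace Ω] {P : Measure Ω} (δ : ℝ → ℝ)
    (X : Lp ℝ ∞ P) : ℝ :=
  (∫ x in Iic (0 : ℝ), δ (distFun X x)) - ∫ x in Ioi (0 : ℝ), (1 - δ (distFun X x))

/-- The acceptance set `A_δ = {X ∈ L^∞ | ρ_δ(X) ≤ 0}`. -/
def acceptanceSet {Ω : Type*} [MeasurableSpace Ω] (P : Measure Ω) (δ : ℝ → ℝ) :
    Set (Lp ℝ ∞ P) :=
  {X | distortionRisk δ X ≤ 0}

/-- The closure in `L^p` of a set `A ⊆ L^∞`, where `L^∞` is regarded as a subspace of `L^p`. -/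
def closureLp {Ω : Type*} [MeasurableSpace Ω] {P : Measure Ω} (p : ℝ≥0∞) [Fact (1 ≤ p)]
    (A : Set (Lp ℝ ∞ P)) : Set (Lp ℝ p P) :=
  closure {f : Lp ℝ p P | ∃ X ∈ A, f =ᵐ[P] X}

/-- The exponents `p ∈ [1,∞)` for which the closure of `A` in `L^p` has nonempty interior
in `L^p`. -/
def finitenessExponents {Ω : Type*} [MeasurableSpace Ω] {P : Measure Ω}
    (A : Set (Lp ℝ ∞ P)) : Set ℝ≥0∞ :=
  {p | p ≠ ∞ ∧ ∃ _ : Fact (1 ≤ p), (interior (closureLp p A)).Nonempty}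

/-- The index of finiteness of the risk measures `ρ_{A,S}` (those that are finite-valued on `L^∞`):
the infimum of the exponents above, which is `∞` if there are none. By definition it depends on
`ρ_{A,S}` through `A` only. -/
def indexOfFiniteness {Ω : Type*} [MeasurableSpace Ω] {P : Measure Ω}
    (A : Set (Lp ℝ ∞ P)) : ℝ≥0∞ :=
  sInf (finitenessExponents A)

/-- The infimum defining the index of finiteness is attained. -/
def IndexAttained {Ω : Type*} [MeasurableSpace Ω] {P : Measure Ω}
    (A : Set (Lp ℝ ∞ P)) : Prop :=
  indexOfFiniteness A ∈ finitenessExponents A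

/-- The right derivative `δ'_+`. -/
def rightDeriv (δ : ℝ → ℝ) (t : ℝ) : ℝ := derivWithin δ (Ioi t) t

/-- `∫_0^1 (δ'_+)^p < ∞`, read for `p = ∞` as boundedness of `δ'_+` on `(0,1)`. -/
def FinitePower (δ : ℝ → ℝ) (p : ℝ≥0∞) : Prop :=
  (p ≠ ∞ ∧ ∫⁻ t in Ioo (0 : ℝ) 1, ENNReal.ofReal (rightDeriv δ t) ^ p.toReal < ∞) ∨
    (p = ∞ ∧ ∃ C : ℝ, ∀ t ∈ Ioo (0 : ℝ) 1, rightDeriv δ t ≤ C)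

/-- `q = sup {p ∈ [1,∞) | ∫_0^1 (δ'_+)^p < ∞}`. -/
def criticalExponent (δ : ℝ → ℝ) : ℝ≥0∞ :=
  sSup {p | 1 ≤ p ∧ p ≠ ∞ ∧ FinitePower δ p}

end DistortionRisk

end

/-!
For `p ∈ [1,∞)` with conjugate exponent `p'`, the closure of `A_δ` in `L^p` has interior points if
and only if `δ'_+ ∈ L^{p'}(0,1)` (`interior_nonempty_iff`). The theorem follows, because
`δ'_+ ∈ L^r` gets weaker as `r` decreases and conjugation of exponents is a decreasing involution
of `[1,∞]`.

*Sufficiency.* For `c ≥ 0`, the risk of `X` is at most `∫_0^∞ δ(P(|X - c| ≥ t)) dt - c`. Writing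
`δ(u)` as the integral of `δ'_+` over `(0,u)` and splitting this integral, at each level `t`,
according to whether `t ^ (p - 1) ≤ δ'_+`, bounds the distorted tail integral of `Y = X - c` by
`∫ (δ'_+)^{p'} + E|Y|^p` (`lintegral_tail_le`), without rearrangements; for `p = 1` it is at most
`sup δ'_+ * E|Y|`. Hence for a large constant `c` every bounded `X` in the unit ball of `L^p` around
`c` is acceptable, and these `X` are dense in that ball.

*Necessity.* Replacing `δ` on `[0,ε]` by its chord gives a smaller distortion with bounded
derivative `w` (`truncDeriv`). If `U` is uniform, then `W = w(U)` is a bounded density with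
`E[W 1_B] ≤ δ(P B)` for all events `B`, so that `E[W X] ≥ 0` for acceptable `X`. Since `W` is
bounded, this inequality passes to the closure in `L^p`, and if the closure contains a ball around
a bounded random variable, then the norms of the `W` in `L^{p'}` are bounded uniformly in `ε`.
Letting `ε` tend to `0` yields `δ'_+ ∈ L^{p'}`. The uniform variable comes from a maximal chain of
events (`Nonatomic.exists_chain`).
-/

namespace DistortionRisk

open Filter Topology

/-! ### Concave distortions and their right derivatives -/

namespace IsConcaveDistortion

variable {δ : ℝ → ℝ} (hδ : IsConcaveDistortion δ)
include hδ

theorem nonneg {u : ℝ} (hu : u ∈ Icc (0 : ℝ) 1) : 0 ≤ δ u := by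
  have := hδ.increasing (left_mem_Icc.2 zero_le_one) hu hu.1
  rwa [hδ.map_zero] at this

theorem le_one {u : ℝ} (hu : u ∈ Icc (0 : ℝ) 1) : δ u ≤ 1 := by
  have := hδ.increasing hu (right_mem_Icc.2 zero_le_one) hu.2
  rwa [hδ.map_one] at this

/-- The graph of `δ` lies above its chords from the origin. -/
theorem mul_le_mul {u v : ℝ} (hu : 0 ≤ u) (huv : u ≤ v) (hv : v ≤ 1) : u * δ v ≤ v * δ u := by
  rcases hu.eq_or_lt with rfl | hu
  · simp [hδ.map_zero]
  have hv0 : 0 < v := hu.trans_le huv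
  have h := hδ.concave.2 (show v ∈ Icc (0 : ℝ) 1 from ⟨hv0.le, hv⟩)
    (show (0 : ℝ) ∈ Icc (0 : ℝ) 1 from ⟨le_rfl, zero_le_one⟩)
    (show 0 ≤ u / v by positivity)
    (show 0 ≤ 1 - u / v by rw [sub_nonneg, div_le_one hv0]; exact huv) (by ring)
  simp only [smul_eq_mul, mul_zero, add_zero, hδ.map_zero, div_mul_cancel₀ u hv0.ne'] at h
  calc u * δ v = v * (u / v * δ v) := by field_simp
    _ ≤ v * δ u := by gcongr

theorem le_self {u : ℝ} (hu : u ∈ Icc (0 : ℝ) 1) : u ≤ δ u := by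
  simpa [hδ.map_one] using hδ.mul_le_mul hu.1 hu.2 le_rfl

theorem continuousOn : ContinuousOn δ (Icc 0 1) := by
  intro u hu
  rcases hu.1.eq_or_lt with rfl | h0
  · exact hδ.continuous_zero
  rcases hu.2.eq_or_lt with rfl | h1
  · rw [ContinuousWithinAt, hδ.map_one]
    refine tendsto_of_tendsto_of_tendsto_of_le_of_le' (g := fun x => x) (h := fun _ => 1)
      (tendsto_nhdsWithin_of_tendsto_nhds tendsto_id) tendsto_const_nhds ?_ ?_
    · filter_upwards [self_mem_nhdsWithin] with x hx using hδ.le_self hx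
    · filter_upwards [self_mem_nhdsWithin] with x hx using hδ.le_one hx
  · have := hδ.concave.continuousOn_interior
    rw [interior_Icc] at this
    exact ((this u ⟨h0, h1⟩).continuousAt (Ioo_mem_nhds h0 h1)).continuousWithinAt

theorem hasDerivWithinAt {t : ℝ} (ht : t ∈ Ioo (0 : ℝ) 1) :
    HasDerivWithinAt δ (rightDeriv δ t) (Ioi t) t := by
  have := (hδ.concave.neg.differentiableWithinAt_Ioi_of_mem_interior (x := t)
    (by rwa [interior_Icc])).neg.hasDerivWithinAt
  simpa [rightDeriv] using this

theorem antitoneOn_rightDeriv : AntitoneOn (rightDeriv δ) (Ioo 0 1) := by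
  have h := hδ.concave.neg.monotoneOn_rightDeriv
  rw [interior_Icc] at h
  intro s hs t ht hst
  have := h hs ht hst
  simp only [derivWithin.neg] at this
  exact neg_le_neg_iff.1 this

theorem rightDeriv_nonneg {t : ℝ} (ht : t ∈ Ioo (0 : ℝ) 1) : 0 ≤ rightDeriv δ t := by
  have h := hδ.concave.slope_le_of_hasDerivWithinAt_Ioi ⟨ht.1.le, ht.2.le⟩
    (right_mem_Icc.2 zero_le_one) ht.2 (hδ.hasDerivWithinAt ht)
  refine le_trans ?_ h
  rw [slope_def_field]
  exact div_nonneg (sub_nonneg.2 (hδ.increasing ⟨ht.1.le, ht.2.le⟩ (right_mem_Icc.2 zero_le_one)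
    ht.2.le)) (sub_nonneg.2 ht.2.le)

theorem rightDeriv_le_div {t : ℝ} (ht : t ∈ Ioo (0 : ℝ) 1) : rightDeriv δ t ≤ δ t / t := by
  -- the right derivative is the limit of `slope δ t s`, and these slopes are at most `δ t / t`
  refine le_of_tendsto ((hasDerivWithinAt_iff_tendsto_slope' self_notMem_Ioi).1
    (hδ.hasDerivWithinAt ht)) ?_
  filter_upwards [Ioo_mem_nhdsGT ht.2] with s hs
  rw [slope_def_field, div_le_div_iff₀ (sub_pos.2 hs.1) ht.1]
  linarith [hδ.mul_le_mul ht.1.le hs.1.le hs.2.le]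

omit hδ in
theorem measurable_rightDeriv : Measurable (rightDeriv δ) :=
  measurable_derivWithin_Ioi δ

theorem intervalIntegrable_rightDeriv {a b : ℝ} (ha : 0 < a) (hab : a ≤ b) (hb : b ≤ 1) :
    IntervalIntegrable (rightDeriv δ) volume a b := by
  rw [intervalIntegrable_iff_integrableOn_Ioo_of_le hab]
  refine Measure.integrableOn_of_bounded (M := rightDeriv δ a) (by simp)
    measurable_rightDeriv.aestronglyMeasurable ?_
  refine (ae_restrict_iff' measurableSet_Ioo).2 (.of_forall fun t ht => ?_)
  have ht' : t ∈ Ioo (0 : ℝ) 1 := ⟨ha.trans ht.1, ht.2.trans_le hb⟩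
  rw [Real.norm_of_nonneg (hδ.rightDeriv_nonneg ht')]
  exact hδ.antitoneOn_rightDeriv ⟨ha, ht.1.trans ht'.2⟩ ht' ht.1.le

theorem integral_rightDeriv {a b : ℝ} (ha : 0 < a) (hab : a ≤ b) (hb : b ≤ 1) :
    ∫ t in a..b, rightDeriv δ t = δ b - δ a :=
  intervalIntegral.integral_eq_sub_of_hasDeriv_right_of_le hab
    (hδ.continuousOn.mono (Icc_subset_Icc ha.le hb))
    (fun _ ht => hδ.hasDerivWithinAt ⟨ha.trans ht.1, ht.2.trans_le hb⟩)
    (hδ.intervalIntegrable_rightDeriv ha hab hb)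

/-- Continuity at `0` excludes a jump there, so that `δ` is recovered from its derivative. -/
theorem ofReal_le_lintegral_rightDeriv {u : ℝ} (hu : u ∈ Icc (0 : ℝ) 1) :
    ENNReal.ofReal (δ u) ≤ ∫⁻ t in Ioo 0 u, ENNReal.ofReal (rightDeriv δ t) := by
  rcases hu.1.eq_or_lt with rfl | h0
  · simp [hδ.map_zero]
  have hlim : Tendsto (fun a => ENNReal.ofReal (δ u - δ a)) (𝓝[>] 0)
      (𝓝 (ENNReal.ofReal (δ u))) := by
    have h : Tendsto δ (𝓝[>] 0) (𝓝 0) := by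
      have := hδ.continuous_zero
      rw [ContinuousWithinAt, hδ.map_zero] at this
      exact this.mono_left (nhdsWithin_le_of_mem (Icc_mem_nhdsGT zero_lt_one))
    simpa using ENNReal.tendsto_ofReal (h.const_sub (δ u))
  refine le_of_tendsto hlim ?_
  filter_upwards [Ioo_mem_nhdsGT h0] with a ha
  rw [← hδ.integral_rightDeriv ha.1 ha.2.le hu.2, intervalIntegral.integral_of_le ha.2.le,
    integral_Ioc_eq_integral_Ioo, ofReal_integral_eq_lintegral_ofReal]
  · exact lintegral_mono_set (Ioo_subset_Ioo_left ha.1.le)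
  · exact (intervalIntegrable_iff_integrableOn_Ioo_of_le ha.2.le).1
      (hδ.intervalIntegrable_rightDeriv ha.1 ha.2.le hu.2)
  · exact (ae_restrict_iff' measurableSet_Ioo).2 (.of_forall fun t ht =>
      hδ.rightDeriv_nonneg ⟨ha.1.trans ht.1, ht.2.trans_le hu.2⟩)

end IsConcaveDistortion

/-- The derivative of the distortion that is linear on `[0, ε]` and agrees with `δ` on `[ε, 1]`,
extended to an antitone function on `ℝ`. -/
noncomputable def truncDeriv (δ : ℝ → ℝ) (ε t : ℝ) : ℝ :=
  if t ≤ ε then δ ε / ε else if t < 1 then rightDeriv δ t else 0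

namespace IsConcaveDistortion

variable {δ : ℝ → ℝ} (hδ : IsConcaveDistortion δ) {ε : ℝ} (hε : ε ∈ Ioo (0 : ℝ) 1)
include hδ hε

theorem truncDeriv_nonneg (t : ℝ) : 0 ≤ truncDeriv δ ε t := by
  unfold truncDeriv
  split_ifs with h1 h2
  · exact div_nonneg (hδ.nonneg ⟨hε.1.le, hε.2.le⟩) hε.1.le
  · exact hδ.rightDeriv_nonneg ⟨hε.1.trans (not_le.1 h1), h2⟩
  · exact le_rfl

theorem truncDeriv_antitone : Antitone (truncDeriv δ ε) := by
  intro s t hst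
  by_cases hs : s ≤ ε
  · rw [truncDeriv, truncDeriv, if_pos hs]
    have h0 := div_nonneg (hδ.nonneg ⟨hε.1.le, hε.2.le⟩) hε.1.le
    split_ifs with h1 h2
    · exact le_rfl
    · have ht : t ∈ Ioo (0 : ℝ) 1 := ⟨hε.1.trans (not_le.1 h1), h2⟩
      exact (hδ.antitoneOn_rightDeriv hε ht (not_le.1 h1).le).trans (hδ.rightDeriv_le_div hε)
    · exact h0
  · by_cases ht : t < 1
    · have hs' := not_le.1 hs
      rw [truncDeriv, truncDeriv, if_neg hs, if_neg (fun h => hs (hst.trans h)), if_pos ht,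
        if_pos (hst.trans_lt ht)]
      exact hδ.antitoneOn_rightDeriv ⟨hε.1.trans hs', hst.trans_lt ht⟩
        ⟨hε.1.trans (hs'.trans_le hst), ht⟩ hst
    · rw [truncDeriv, if_neg (fun h => hs (hst.trans h)), if_neg ht]
      exact hδ.truncDeriv_nonneg hε s

theorem measurable_truncDeriv : Measurable (truncDeriv δ ε) :=
  (hδ.truncDeriv_antitone hε).measurable

theorem truncDeriv_le (t : ℝ) : truncDeriv δ ε t ≤ δ ε / ε := by
  rcases le_total t ε with h | h
  · simp [truncDeriv, h]
  · simpa [truncDeriv] using hδ.truncDeriv_antitone hε h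

theorem integrableOn_truncDeriv (a b : ℝ) : IntegrableOn (truncDeriv δ ε) (Ioc a b) :=
  Measure.integrableOn_of_bounded (M := δ ε / ε) (by simp)
    (hδ.measurable_truncDeriv hε).aestronglyMeasurable
    (.of_forall fun t => by
      rw [Real.norm_of_nonneg (hδ.truncDeriv_nonneg hε t)]; exact hδ.truncDeriv_le hε t)

omit hδ hε in
theorem integral_truncDeriv_of_le {b : ℝ} (hb0 : 0 ≤ b) (hb : b ≤ ε) :
    ∫ t in Ioc 0 b, truncDeriv δ ε t = b * (δ ε / ε) := by
  rw [setIntegral_congr_fun (g := fun _ => δ ε / ε) measurableSet_Ioc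
    (fun t ht => by simp [truncDeriv, ht.2.trans hb])]
  simp [hb0]

theorem integral_truncDeriv_of_ge {b : ℝ} (hb : ε ≤ b) (hb1 : b ≤ 1) :
    ∫ t in Ioc 0 b, truncDeriv δ ε t = δ b := by
  have h0 := hε.1
  rw [← Ioc_union_Ioc_eq_Ioc h0.le hb, setIntegral_union (Ioc_disjoint_Ioc_of_le le_rfl)
    measurableSet_Ioc (hδ.integrableOn_truncDeriv hε _ _) (hδ.integrableOn_truncDeriv hε _ _),
    integral_truncDeriv_of_le h0.le le_rfl, integral_Ioc_eq_integral_Ioo (x := ε),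
    setIntegral_congr_fun (g := rightDeriv δ) measurableSet_Ioo
      (fun t ht => by simp [truncDeriv, not_le.2 ht.1, ht.2.trans_le hb1]),
    ← integral_Ioc_eq_integral_Ioo, ← intervalIntegral.integral_of_le hb,
    hδ.integral_rightDeriv h0 hb hb1]
  field_simp
  ring

theorem integral_truncDeriv_le {b : ℝ} (hb : b ∈ Icc (0 : ℝ) 1) :
    ∫ t in Ioc 0 b, truncDeriv δ ε t ≤ δ b := by
  rcases le_total b ε with h | h
  · rw [integral_truncDeriv_of_le hb.1 h, mul_div_assoc', div_le_iff₀ hε.1,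
      mul_comm (δ b)]
    exact hδ.mul_le_mul hb.1 h hε.2.le
  · exact (hδ.integral_truncDeriv_of_ge hε h hb.2).le

end IsConcaveDistortion

/-! ### Uniform random variables on nonatomic spaces -/

section Uniform

variable {Ω : Type*} [MeasurableSpace Ω] {P : Measure Ω}

theorem measure_iUnion_le_of_ae_mono {A : ℕ → Set Ω}
    (hA : ∀ m n, m ≤ n → A m ≤ᵐ[P] A n) {t : ℝ≥0∞} (ht : ∀ n, P (A n) ≤ t) :
    P (⋃ n, A n) ≤ t := by
  rw [measure_iUnion_eq_iSup_accumulate]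
  refine iSup_le fun n => (measure_mono_ae ?_).trans (ht n)
  rw [accumulate_def]
  have : (⋃ m ∈ {m | m ≤ n}, A m) ≤ᵐ[P] ⋃ m ∈ {m | m ≤ n}, A n :=
    Filter.EventuallyLE.countable_bUnion (to_countable _) fun m hm => hA m n hm
  exact this.trans (LE.le.eventuallyLE (iUnion₂_subset fun _ _ => subset_rfl))

variable [IsProbabilityMeasure P]

/-- A nonatomic probability space carries a chain of events, increasing up to null sets, whose
probabilities fill `[0,1]`. A maximal chain has this property: a gap in its probabilities could be
filled with part of the event between the two members that bound it. -/
theorem Nonatomic.exists_chain (hP : Nonatomic P) :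
    ∃ A : ℝ → Set Ω, (∀ t, MeasurableSet (A t)) ∧
      (∀ t ∈ Icc (0 : ℝ) 1, P (A t) = ENNReal.ofReal t) ∧
      ∀ s ∈ Icc (0 : ℝ) 1, ∀ t ∈ Icc (0 : ℝ) 1, s ≤ t → A s ≤ᵐ[P] A t := by
  let r : {A : Set Ω // MeasurableSet A} → {A : Set Ω // MeasurableSet A} → Prop :=
    fun A B => A.1 ≤ᵐ[P] B.1
  let C : Set {A : Set Ω // MeasurableSet A} := maxChain r
  have hC : IsMaxChain r C := maxChain_spec
  have htot : ∀ A ∈ C, ∀ B ∈ C, A.1 ≤ᵐ[P] B.1 ∨ B.1 ≤ᵐ[P] A.1 := fun A hA B hB => by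
    rcases eq_or_ne A B with rfl | h
    · exact .inl EventuallyLE.rfl
    · exact hC.1 hA hB h
  have hmono : ∀ A ∈ C, ∀ B ∈ C, P A.1 ≤ P B.1 → A.1 ≤ᵐ[P] B.1 := fun A hA B hB h => by
    rcases htot A hA B hB with h' | h'
    · exact h'
    · exact (ae_eq_of_ae_subset_of_measure_ge h' h B.2.nullMeasurableSet
        (measure_ne_top _ _)).symm.le
  have hmem : ∀ D : {A : Set Ω // MeasurableSet A},
      (∀ A ∈ C, D.1 ≤ᵐ[P] A.1 ∨ A.1 ≤ᵐ[P] D.1) → D ∈ C := fun D hD => by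
    have := hC.2 (hC.1.insert (a := D) fun b hb _ => hD b hb) (subset_insert D C)
    rw [this]
    exact mem_insert _ _
  have hval : ∀ t : ℝ≥0∞, t ≤ 1 → ∃ A ∈ C, P A.1 = t := by
    intro t ht
    -- `A` is the largest member of the chain of probability at most `t`
    obtain ⟨A, hAC, hAt, hAmax⟩ : ∃ A ∈ C, P A.1 ≤ t ∧ ∀ F ∈ C, P F.1 ≤ t → F.1 ≤ᵐ[P] A.1 := by
      have hne : ((fun A : {A : Set Ω // MeasurableSet A} => P A.1) ''
          {A ∈ C | P A.1 ≤ t}).Nonempty :=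
        ⟨_, ⟨∅, MeasurableSet.empty⟩, ⟨hmem _ fun A _ =>
          .inl (LE.le.eventuallyLE (empty_subset _)), by simp⟩, rfl⟩
      obtain ⟨u, hu, hlim, hmemu⟩ := exists_seq_tendsto_sSup hne (OrderTop.bddAbove _)
      choose A hA hAu using hmemu
      have hch : ∀ m n, m ≤ n → (A m).1 ≤ᵐ[P] (A n).1 := fun m n hmn =>
        hmono _ (hA m).1 _ (hA n).1 (by
          have := hu hmn
          rwa [← hAu m, ← hAu n] at this)
      have hsup : ∀ F ∈ C, P F.1 ≤ t → ∀ s, (∀ n, P (A n).1 ≤ s) → P F.1 ≤ s :=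
        fun F hF hFt s hs => le_trans (le_csSup (OrderTop.bddAbove _) (mem_image_of_mem
            (fun A : {A : Set Ω // MeasurableSet A} => P A.1)
            (show F ∈ {A ∈ C | P A.1 ≤ t} from ⟨hF, hFt⟩)))
          (le_of_tendsto' hlim fun n => by rw [← hAu n]; exact hs n)
      have hle : P (⋃ n, (A n).1) ≤ t := measure_iUnion_le_of_ae_mono hch fun n => (hA n).2
      have hUC : (⟨⋃ n, (A n).1, MeasurableSet.iUnion fun n => (A n).2⟩ :
          {A : Set Ω // MeasurableSet A}) ∈ C := by
        refine hmem _ fun F hF => ?_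
        by_cases h : ∃ n, F.1 ≤ᵐ[P] (A n).1
        · obtain ⟨n, hn⟩ := h
          exact .inr (hn.trans (LE.le.eventuallyLE (subset_iUnion (fun n => (A n).1) n)))
        · left
          have : (⋃ n, (A n).1) ≤ᵐ[P] ⋃ _ : ℕ, F.1 := Filter.EventuallyLE.countable_iUnion fun n =>
            (htot _ (hA n).1 F hF).resolve_right fun h' => h ⟨n, h'⟩
          rwa [iUnion_const] at this
      exact ⟨_, hUC, hle, fun F hF hFt => hmono F hF _ hUC (hsup F hF hFt _ fun n =>
        measure_mono (subset_iUnion (fun n => (A n).1) n))⟩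
    -- `B` is the smallest member of the chain of probability at least `t`
    obtain ⟨B, hBC, hBt, hBmin⟩ : ∃ B ∈ C, t ≤ P B.1 ∧ ∀ F ∈ C, t ≤ P F.1 → B.1 ≤ᵐ[P] F.1 := by
      have hne : ((fun A : {A : Set Ω // MeasurableSet A} => P A.1) ''
          {A ∈ C | t ≤ P A.1}).Nonempty :=
        ⟨_, ⟨univ, MeasurableSet.univ⟩, ⟨hmem _ fun A _ =>
          .inr (LE.le.eventuallyLE (subset_univ _)), by simpa using ht⟩, rfl⟩
      obtain ⟨u, hu, hlim, hmemu⟩ := exists_seq_tendsto_sInf hne (OrderBot.bddBelow _)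
      choose B hB hBu using hmemu
      have hch : ∀ m n, m ≤ n → (B n).1 ≤ᵐ[P] (B m).1 := fun m n hmn =>
        hmono _ (hB n).1 _ (hB m).1 (by
          have := hu hmn
          rwa [← hBu m, ← hBu n] at this)
      have hinf : ∀ F ∈ C, t ≤ P F.1 → ∀ s, (∀ n, s ≤ P (B n).1) → s ≤ P F.1 :=
        fun F hF hFt s hs => le_trans (ge_of_tendsto' hlim fun n => by rw [← hBu n]; exact hs n)
          (csInf_le (OrderBot.bddBelow _) (mem_image_of_mem
            (fun A : {A : Set Ω // MeasurableSet A} => P A.1)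
            (show F ∈ {A ∈ C | t ≤ P A.1} from ⟨hF, hFt⟩)))
      have hmeas : MeasurableSet (⋂ n, (B n).1) := MeasurableSet.iInter fun n => (B n).2
      have hge : t ≤ P (⋂ n, (B n).1) := by
        have h := measure_iUnion_le_of_ae_mono (P := P) (A := fun n => (B n).1ᶜ) (t := 1 - t)
          (fun m n hmn => (hch m n hmn).compl) fun n => by
            rw [prob_compl_eq_one_sub (B n).2]
            exact tsub_le_tsub_left (hB n).2 1
        rw [← compl_iInter, prob_compl_eq_one_sub hmeas] at h
        exact (ENNReal.sub_le_sub_iff_left ht ENNReal.one_ne_top).1 h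
      have hIC : (⟨⋂ n, (B n).1, hmeas⟩ : {A : Set Ω // MeasurableSet A}) ∈ C := by
        refine hmem _ fun F hF => ?_
        by_cases h : ∃ n, (B n).1 ≤ᵐ[P] F.1
        · obtain ⟨n, hn⟩ := h
          exact .inl ((LE.le.eventuallyLE (iInter_subset (fun n => (B n).1) n)).trans hn)
        · right
          have : (⋂ _ : ℕ, F.1) ≤ᵐ[P] ⋂ n, (B n).1 := Filter.EventuallyLE.countable_iInter fun n =>
            (htot _ (hB n).1 F hF).resolve_left fun h' => h ⟨n, h'⟩
          rwa [iInter_const] at this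
      exact ⟨_, hIC, hge, fun F hF hFt => hmono _ hIC F hF (hinf F hF hFt _ fun n =>
        measure_mono (iInter_subset (fun n => (B n).1) n))⟩
    by_contra! hno
    have hAt' : P A.1 < t := hAt.lt_of_ne (hno A hAC)
    have hBt' : t < P B.1 := hBt.lt_of_ne (hno B hBC).symm
    have hAB : A.1 ≤ᵐ[P] B.1 := hmono A hAC B hBC (hAt'.trans hBt').le
    have hadd : P A.1 + P (B.1 \ A.1) ≤ P B.1 := by
      rw [← measure_union disjoint_sdiff_right (B.2.diff A.2)]
      refine measure_mono_ae ?_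
      have := hAB.union (LE.le.eventuallyLE (l := ae P) (sdiff_subset (s := B.1) (t := A.1)))
      simpa using this
    have hpos : 0 < P (B.1 \ A.1) := by
      refine pos_iff_ne_zero.2 fun h0 => (hAt'.trans hBt').not_ge ?_
      exact (measure_mono_ae (ae_le_set.2 h0))
    obtain ⟨D, hDsub, hD, hD0, hDlt⟩ := hP _ (B.2.diff A.2) hpos
    have hdisj : Disjoint A.1 D := disjoint_sdiff_right.mono_right hDsub
    have hPE : P (A.1 ∪ D) = P A.1 + P D := measure_union hdisj hD
    have hEC : (⟨A.1 ∪ D, A.2.union hD⟩ : {A : Set Ω // MeasurableSet A}) ∈ C := by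
      refine hmem _ fun F hF => ?_
      rcases le_total (P F.1) t with h | h
      · exact .inr ((hAmax F hF h).trans (LE.le.eventuallyLE subset_union_left))
      · left
        refine EventuallyLE.trans ?_ (hBmin F hF h)
        have := hAB.union (LE.le.eventuallyLE (l := ae P) (hDsub.trans sdiff_subset))
        simpa using this
    rcases le_total (P (A.1 ∪ D)) t with h | h
    · have := measure_mono_ae (hAmax _ hEC h)
      rw [hPE] at this
      exact (ENNReal.lt_add_right (measure_ne_top P A.1) hD0.ne').not_ge this
    · have := measure_mono_ae (hBmin _ hEC h)
      rw [hPE] at this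
      exact (ENNReal.add_lt_add_left (measure_ne_top P A.1) hDlt).not_ge (hadd.trans this)
  have hex : ∀ t : ℝ, ∃ A ∈ C, t ∈ Icc (0 : ℝ) 1 → P A.1 = ENNReal.ofReal t := fun t => by
    by_cases ht : t ∈ Icc (0 : ℝ) 1
    · obtain ⟨A, hA, h⟩ := hval (ENNReal.ofReal t) (by simpa using ht.2)
      exact ⟨A, hA, fun _ => h⟩
    · obtain ⟨A, hA, -⟩ := hval 0 zero_le_one
      exact ⟨A, hA, fun h => absurd h ht⟩
  choose A hAC hA using hex
  refine ⟨fun t => (A t).1, fun t => (A t).2, fun t ht => hA t ht, fun s hs t ht hst => ?_⟩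
  refine hmono _ (hAC s) _ (hAC t) ?_
  rw [hA s hs, hA t ht]
  exact ENNReal.ofReal_le_ofReal hst

/-- A nonatomic probability space carries a random variable that is uniform on `(0,1]`. -/
theorem Nonatomic.exists_uniform (hP : Nonatomic P) :
    ∃ U : Ω → ℝ, Measurable U ∧ P.map U = volume.restrict (Ioc 0 1) := by
  obtain ⟨A, hAm, hAP, hA⟩ := hP.exists_chain
  classical
  -- `U ω` is the infimum of the rational levels `q` with `ω ∈ A q`
  let ι := {q : ℚ // (q : ℝ) ∈ Icc (0 : ℝ) 1}
  have : Nonempty ι := ⟨⟨0, by simp⟩⟩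
  let f : ι → Ω → ℝ := fun q => (A q.1).piecewise (fun _ => (q.1 : ℝ)) fun _ => 1
  let U : Ω → ℝ := fun ω => ⨅ q, f q ω
  have hf : ∀ q ω, f q ω = if ω ∈ A q.1 then (q.1 : ℝ) else 1 := fun q ω => rfl
  have hf0 : ∀ q ω, f q ω ∈ Icc (0 : ℝ) 1 := fun q ω => by
    rw [hf]
    split_ifs
    · exact q.2
    · simp
  have hbdd : ∀ ω, BddBelow (range fun q => f q ω) := fun ω => ⟨0, by
    rintro _ ⟨q, rfl⟩; exact (hf0 q ω).1⟩
  have hU : Measurable U := Measurable.iInf fun q =>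
    Measurable.piecewise (hAm q.1) measurable_const measurable_const
  have hU01 : ∀ ω, U ω ∈ Icc (0 : ℝ) 1 := fun ω =>
    ⟨le_ciInf fun q => (hf0 q ω).1,
      (ciInf_le (hbdd ω) (Classical.arbitrary ι)).trans (hf0 _ ω).2⟩
  have hlt : ∀ s : ℝ, 0 < s → s ≤ 1 → P.real {ω | U ω < s} = s := by
    intro s hs0 hs1
    have hset : {ω | U ω < s} = ⋃ q : ι, ⋃ _ : (q.1 : ℝ) < s, A q.1 := by
      ext ω
      simp only [mem_ofPred_eq, mem_iUnion, exists_prop]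
      refine (ciInf_lt_iff (hbdd ω)).trans ?_
      simp only [hf]
      refine exists_congr fun q => ?_
      split_ifs with h
      · simp [h]
      · simp [h, hs1]
    rw [hset]
    refine le_antisymm ?_ (le_of_forall_lt fun r hr => ?_)
    · have hle : (⋃ q : ι, ⋃ _ : (q.1 : ℝ) < s, A q.1) ≤ᵐ[P] ⋃ _ : ι, A s :=
        Filter.EventuallyLE.countable_iUnion fun q => by
          by_cases hq : (q.1 : ℝ) < s
          · simpa [hq] using hA _ q.2 s ⟨hs0.le, hs1⟩ hq.le
          · simpa [hq] using LE.le.eventuallyLE (l := ae P) (empty_subset (A s))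
      have := measure_mono_ae hle
      rw [iUnion_const, hAP s ⟨hs0.le, hs1⟩] at this
      exact ENNReal.toReal_le_of_le_ofReal hs0.le this
    · obtain ⟨q, hq1, hq2⟩ := exists_rat_btwn (max_lt hr hs0)
      have hq : (q : ℝ) ∈ Icc (0 : ℝ) 1 := ⟨(le_max_right _ _).trans hq1.le, hq2.le.trans hs1⟩
      calc r < q := (le_max_left _ _).trans_lt hq1
        _ = P.real (A q) := by rw [measureReal_def, hAP _ hq, ENNReal.toReal_ofReal hq.1]
        _ ≤ _ := measureReal_mono (subset_iUnion₂_of_subset (⟨q, hq⟩ : ι) hq2 subset_rfl)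
          (measure_ne_top _ _)
  refine ⟨U, hU, Measure.ext_of_Ici _ _ fun s => ?_⟩
  rw [Measure.map_apply hU measurableSet_Ici, Measure.restrict_apply measurableSet_Ici]
  rcases le_or_gt s 0 with hs0 | hs0
  · rw [show U ⁻¹' Ici s = univ from eq_univ_of_forall fun ω => hs0.trans (hU01 ω).1,
      inter_eq_right.2 (show Ioc (0 : ℝ) 1 ⊆ Ici s from fun x hx => hs0.trans hx.1.le)]
    simp
  rcases le_or_gt s 1 with hs1 | hs1
  · have h : U ⁻¹' Ici s = {ω | U ω < s}ᶜ := by ext; simp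
    have h' : Ici s ∩ Ioc 0 1 = Icc s 1 := by
      ext x; simp only [mem_inter_iff, mem_Ici, mem_Ioc, mem_Icc]
      exact ⟨fun h => ⟨h.1, h.2.2⟩, fun h => ⟨h.1, hs0.trans_le h.1, h.2⟩⟩
    rw [h, h', Real.volume_Icc, ← ofReal_measureReal, probReal_compl_eq_one_sub
      (measurableSet_lt hU measurable_const), hlt s hs0 hs1]
  · rw [show U ⁻¹' Ici s = ∅ from eq_empty_of_forall_notMem fun ω h =>
        (hs1.trans_le h).not_ge (hU01 ω).2,
      show Ici s ∩ Ioc 0 1 = ∅ from eq_empty_of_forall_notMem fun ω h =>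
        (hs1.trans_le h.1).not_ge h.2.2]
    simp

end Uniform

/-! ### The distortion risk measure and the sufficient condition -/

section Risk

variable {Ω : Type*} [MeasurableSpace Ω] {P : Measure Ω}

theorem exists_ae_abs_le (X : Lp ℝ ∞ P) : ∃ M : ℝ, 0 ≤ M ∧ ∀ᵐ ω ∂P, |X ω| ≤ M := by
  refine ⟨‖X‖, norm_nonneg _, ?_⟩
  have h := ae_le_eLpNormEssSup (f := X) (μ := P)
  filter_upwards [h] with ω hω
  rw [Lp.norm_def, eLpNorm_exponent_top, ← Real.norm_eq_abs, ← toReal_enorm]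
  refine ENNReal.toReal_mono ?_ hω
  rw [← eLpNorm_exponent_top]
  exact Lp.eLpNorm_ne_top X

variable [IsProbabilityMeasure P] {δ : ℝ → ℝ}

theorem distFun_mem_Icc (X : Lp ℝ ∞ P) (x : ℝ) : distFun X x ∈ Icc (0 : ℝ) 1 :=
  ⟨measureReal_nonneg, measureReal_le_one⟩

theorem monotone_distFun (X : Lp ℝ ∞ P) : Monotone (distFun X) := fun _ _ h =>
  measureReal_mono (fun _ hω => le_trans hω h) (measure_ne_top _ _)

omit [IsProbabilityMeasure P] in
theorem distFun_eq_zero {X : Lp ℝ ∞ P} {M x : ℝ} (hM : ∀ᵐ ω ∂P, |X ω| ≤ M) (hx : x < -M) :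
    distFun X x = 0 := by
  rw [distFun, measureReal_def, ENNReal.toReal_eq_zero_iff]
  left
  refine measure_mono_null ?_ hM
  exact fun ω hω (h : |X ω| ≤ M) => by
    have h1 : X ω ≤ x := hω
    linarith [(abs_le.1 h).1]

theorem distFun_eq_one {X : Lp ℝ ∞ P} {c x : ℝ} (hc : ∀ᵐ ω ∂P, X ω ≤ c) (hx : c ≤ x) :
    distFun X x = 1 := by
  have : {ω | X ω ≤ x} =ᵐ[P] (univ : Set Ω) := by
    filter_upwards [hc] with ω hω
    exact propext (iff_of_true (hω.trans hx) trivial)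
  rw [distFun, measureReal_congr this, probReal_univ]

namespace IsConcaveDistortion

variable (hδ : IsConcaveDistortion δ) (X : Lp ℝ ∞ P)
include hδ

theorem monotone_comp_distFun : Monotone fun x => δ (distFun X x) := fun _ _ h =>
  hδ.increasing (distFun_mem_Icc X _) (distFun_mem_Icc X _) (monotone_distFun X h)

theorem integrableOn_comp_distFun (c : ℝ) : IntegrableOn (fun x => δ (distFun X x)) (Iic c) := by
  obtain ⟨M, -, hM⟩ := exists_ae_abs_le X
  have hφ := hδ.monotone_comp_distFun X
  have h : IntegrableOn (fun x => δ (distFun X x)) (Icc (-M) c) :=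
    hφ.locallyIntegrable.integrableOn_isCompact isCompact_Icc
  refine h.of_forall_sdiff_eq_zero measurableSet_Iic fun x hx => ?_
  have : x < -M := by
    by_contra! h
    exact hx.2 ⟨h, hx.1⟩
  rw [distFun_eq_zero hM this, hδ.map_zero]

theorem integrableOn_one_sub_comp_distFun (c : ℝ) :
    IntegrableOn (fun x => 1 - δ (distFun X x)) (Ioi c) := by
  obtain ⟨M, -, hM⟩ := exists_ae_abs_le X
  have hφ : Antitone fun x => 1 - δ (distFun X x) := fun _ _ h =>
    sub_le_sub_left (hδ.monotone_comp_distFun X h) 1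
  have h : IntegrableOn (fun x => 1 - δ (distFun X x)) (Icc c M) :=
    hφ.locallyIntegrable.integrableOn_isCompact isCompact_Icc
  refine h.of_forall_sdiff_eq_zero measurableSet_Ioi fun x hx => ?_
  have : M ≤ x := by
    by_contra! h
    exact hx.2 ⟨hx.1.le, h.le⟩
  rw [distFun_eq_one (hM.mono fun ω h => (le_abs_self _).trans h) this, hδ.map_one, sub_self]

/-- The substitution `x = c - t` turns the distribution function of `X` into the tail of `c - X`. -/
theorem integrableOn_tail (c : ℝ) :
    IntegrableOn (fun t => δ (P.real {ω | t ≤ c - X ω})) (Ici 0) ∧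
      ∫ t in Ici 0, δ (P.real {ω | t ≤ c - X ω}) = ∫ x in Iic c, δ (distFun X x) := by
  have hmp := Measure.measurePreserving_sub_left (volume : Measure ℝ) c
  have hemb : MeasurableEmbedding fun t : ℝ => c - t :=
    (MeasurableEquiv.subLeft c).measurableEmbedding
  have hpre : (fun t => c - t) ⁻¹' Iic c = Ici (0 : ℝ) := by ext; simp
  have heq : ∀ t, δ (P.real {ω | t ≤ c - X ω}) = δ (distFun X (c - t)) := fun t => by
    simp only [distFun, le_sub_comm]
  constructor
  · have := (hmp.integrableOn_comp_preimage hemb (f := fun x => δ (distFun X x)) (s := Iic c)).2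
      (hδ.integrableOn_comp_distFun X c)
    rw [hpre] at this
    simpa only [heq, Function.comp_def] using this
  · rw [← hmp.setIntegral_preimage_emb hemb (fun x => δ (distFun X x)) (Iic c), hpre]
    simp only [heq]

/-- A form of cash additivity: for `X ≤ c` the second summand vanishes, and the risk of `X` is the
risk `∫_0^∞ δ(P(c - X ≥ t)) dt` of `X - c ≤ 0`, minus `c`. In general that summand is nonnegative,
so that the right-hand side is an upper bound of the risk. -/
theorem distortionRisk_add_integral {c : ℝ} (hc : 0 ≤ c) :
    distortionRisk δ X + ∫ x in Ioi c, (1 - δ (distFun X x)) =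
      (∫ t in Ici 0, δ (P.real {ω | t ≤ c - X ω})) - c := by
  have h1 : IntegrableOn (fun x => δ (distFun X x)) (Ioc 0 c) :=
    (hδ.integrableOn_comp_distFun X c).mono_set Ioc_subset_Iic_self
  have e1 : ∫ x in Iic c, δ (distFun X x) =
      (∫ x in Iic 0, δ (distFun X x)) + ∫ x in Ioc 0 c, δ (distFun X x) := by
    rw [← setIntegral_union (Iic_disjoint_Ioc le_rfl) measurableSet_Ioc
      (hδ.integrableOn_comp_distFun X 0) h1, Iic_union_Ioc_eq_Iic hc]
  have e2 : ∫ x in Ioi 0, (1 - δ (distFun X x)) =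
      (∫ x in Ioc 0 c, (1 - δ (distFun X x))) + ∫ x in Ioi c, (1 - δ (distFun X x)) := by
    have h := hδ.integrableOn_one_sub_comp_distFun X 0
    rw [← setIntegral_union (Ioc_disjoint_Ioi le_rfl) measurableSet_Ioi
      (h.mono_set Ioc_subset_Ioi_self) (hδ.integrableOn_one_sub_comp_distFun X c),
      Ioc_union_Ioi_eq_Ioi hc]
  have e3 : ∫ x in Ioc 0 c, (1 - δ (distFun X x)) = c - ∫ x in Ioc 0 c, δ (distFun X x) := by
    rw [integral_sub (by simp) h1]
    simp [hc]
  rw [(hδ.integrableOn_tail X c).2, distortionRisk, e1, e2, e3]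
  ring

theorem distortionRisk_eq {c : ℝ} (hc : 0 ≤ c) (hX : ∀ᵐ ω ∂P, X ω ≤ c) :
    distortionRisk δ X = (∫ t in Ici 0, δ (P.real {ω | t ≤ c - X ω})) - c := by
  rw [← hδ.distortionRisk_add_integral X hc, setIntegral_eq_zero_of_forall_eq_zero, add_zero]
  intro x hx
  rw [distFun_eq_one hX (le_of_lt hx), hδ.map_one, sub_self]

theorem mem_acceptanceSet_of_lintegral_le {c : ℝ} (hc : 0 ≤ c)
    (h : ∫⁻ t in Ioi (0 : ℝ), ENNReal.ofReal (δ (P.real {ω | t ≤ |X ω - c|})) ≤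
      ENNReal.ofReal c) : X ∈ acceptanceSet P δ := by
  have hR : 0 ≤ ∫ x in Ioi c, (1 - δ (distFun X x)) :=
    integral_nonneg fun x => sub_nonneg.2 (hδ.le_one (distFun_mem_Icc X x))
  have hle : ∫ t in Ici 0, δ (P.real {ω | t ≤ c - X ω}) ≤ c := by
    have hint := (hδ.integrableOn_tail X c).1
    rw [integral_eq_lintegral_of_nonneg_ae (.of_forall fun t =>
      hδ.nonneg ⟨measureReal_nonneg, measureReal_le_one⟩) hint.aestronglyMeasurable,
      setLIntegral_congr Ioi_ae_eq_Ici.symm]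
    refine ENNReal.toReal_le_of_le_ofReal hc (le_trans (lintegral_mono fun t => ?_) h)
    refine ENNReal.ofReal_le_ofReal (hδ.increasing ⟨measureReal_nonneg, measureReal_le_one⟩
      ⟨measureReal_nonneg, measureReal_le_one⟩ (measureReal_mono (fun ω hω => ?_)
        (measure_ne_top _ _)))
    have h1 : t ≤ c - X ω := hω
    exact h1.trans (by rw [abs_sub_comm]; exact le_abs_self _)
  have := hδ.distortionRisk_add_integral X hc
  change distortionRisk δ X ≤ 0
  linarith

/-- The distorted tail integral is controlled by an `L^p` norm once `δ'_+ ∈ L^q`. For each `t`, the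
integral of `δ'_+` over `(0, P(|Y| ≥ t))` is split according to whether `t ^ (p - 1) ≤ δ'_+`; this
amounts to Young's inequality. -/
theorem lintegral_tail_le {p q : ℝ} (hpq : p.HolderConjugate q) {Y : Ω → ℝ}
    (hY : AEMeasurable Y P) :
    ∫⁻ t in Ioi (0 : ℝ), ENNReal.ofReal (δ (P.real {ω | t ≤ |Y ω|})) ≤
      (∫⁻ s in Ioo (0 : ℝ) 1, ENNReal.ofReal (rightDeriv δ s) ^ q) +
        ∫⁻ ω, ENNReal.ofReal (|Y ω| ^ p) ∂P := by
  set g := rightDeriv δ with hg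
  have hgm : Measurable g := measurable_rightDeriv
  let k : ℝ → ℝ → ℝ≥0∞ := fun t s => if t ^ (p - 1) ≤ g s then ENNReal.ofReal (g s) else 0
  have hk : Measurable (Function.uncurry k) := by
    refine Measurable.ite (measurableSet_le ?_ ?_) ?_ measurable_const
    · exact measurable_fst.pow_const _
    · exact hgm.comp measurable_snd
    · exact (hgm.comp measurable_snd).ennreal_ofReal
  have hpt : ∀ t ∈ Ioi (0 : ℝ), ENNReal.ofReal (δ (P.real {ω | t ≤ |Y ω|})) ≤
      (∫⁻ s in Ioo (0 : ℝ) 1, k t s) + P {ω | t ≤ |Y ω|} * ENNReal.ofReal (t ^ (p - 1)) := by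
    intro t ht
    have hG : P.real {ω | t ≤ |Y ω|} ∈ Icc (0 : ℝ) 1 := ⟨measureReal_nonneg, measureReal_le_one⟩
    calc ENNReal.ofReal (δ (P.real {ω | t ≤ |Y ω|}))
        ≤ ∫⁻ s in Ioo 0 (P.real {ω | t ≤ |Y ω|}), ENNReal.ofReal (g s) :=
          hδ.ofReal_le_lintegral_rightDeriv hG
      _ ≤ ∫⁻ s in Ioo 0 (P.real {ω | t ≤ |Y ω|}), (k t s + ENNReal.ofReal (t ^ (p - 1))) := by
          refine lintegral_mono fun s => ?_
          by_cases h : t ^ (p - 1) ≤ g s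
          · simp [k, h]
          · simpa [k, h] using ENNReal.ofReal_le_ofReal (not_le.1 h).le
      _ = (∫⁻ s in Ioo 0 (P.real {ω | t ≤ |Y ω|}), k t s) +
            P {ω | t ≤ |Y ω|} * ENNReal.ofReal (t ^ (p - 1)) := by
          rw [lintegral_add_right _ measurable_const, setLIntegral_const, Real.volume_Ioo, sub_zero,
            ofReal_measureReal, mul_comm]
      _ ≤ _ := by gcongr; exact hG.2
  have hk1 : ∀ s ∈ Ioo (0 : ℝ) 1, ∫⁻ t in Ioi (0 : ℝ), k t s ≤ ENNReal.ofReal (g s) ^ q := by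
    intro s hs
    have hgs : 0 ≤ g s := hδ.rightDeriv_nonneg hs
    calc ∫⁻ t in Ioi (0 : ℝ), k t s
        ≤ ∫⁻ t in Ioi (0 : ℝ), (Ioc 0 (g s ^ (q - 1))).indicator
            (fun _ => ENNReal.ofReal (g s)) t := by
          refine setLIntegral_mono (measurable_const.indicator measurableSet_Ioc) fun t ht => ?_
          by_cases h : t ^ (p - 1) ≤ g s
          · have ht' : t ∈ Ioc 0 (g s ^ (q - 1)) := by
              refine ⟨ht, ?_⟩
              calc t = (t ^ (p - 1)) ^ (q - 1) := by
                    rw [← Real.rpow_mul (le_of_lt ht), show (p - 1) * (q - 1) = 1 by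
                      linarith [hpq.mul_eq_add], Real.rpow_one]
                _ ≤ g s ^ (q - 1) := Real.rpow_le_rpow (Real.rpow_nonneg (le_of_lt ht) _) h
                    hpq.symm.sub_one_pos.le
            simp [k, h, ht']
          · simp [k, h]
      _ ≤ ENNReal.ofReal (g s) * ENNReal.ofReal (g s ^ (q - 1)) := by
          refine (setLIntegral_le_lintegral _ _).trans ?_
          rw [lintegral_indicator_const measurableSet_Ioc, Real.volume_Ioc, sub_zero]
      _ = ENNReal.ofReal (g s) ^ q := by
          rw [← ENNReal.ofReal_mul hgs, ENNReal.ofReal_rpow_of_nonneg hgs hpq.symm.nonneg]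
          rcases hgs.eq_or_lt with h | h
          · simp [← h, hpq.symm.ne_zero]
          · rw [← Real.rpow_one_add' hgs (by simpa using hpq.symm.ne_zero), add_sub_cancel]
  calc ∫⁻ t in Ioi (0 : ℝ), ENNReal.ofReal (δ (P.real {ω | t ≤ |Y ω|}))
      ≤ ∫⁻ t in Ioi (0 : ℝ), ((∫⁻ s in Ioo (0 : ℝ) 1, k t s) +
          P {ω | t ≤ |Y ω|} * ENNReal.ofReal (t ^ (p - 1))) :=
        setLIntegral_mono' measurableSet_Ioi hpt
    _ = (∫⁻ t in Ioi (0 : ℝ), ∫⁻ s in Ioo (0 : ℝ) 1, k t s) +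
          ∫⁻ t in Ioi (0 : ℝ), P {ω | t ≤ |Y ω|} * ENNReal.ofReal (t ^ (p - 1)) :=
        lintegral_add_left hk.lintegral_prod_right' _
    _ ≤ _ := by
        gcongr ?_ + ?_
        · rw [lintegral_lintegral_swap hk.aemeasurable]
          exact setLIntegral_mono' measurableSet_Ioo hk1
        · rw [lintegral_rpow_eq_lintegral_meas_le_mul P (.of_forall fun ω => abs_nonneg (Y ω))
            hY.abs hpq.pos]
          exact le_mul_of_one_le_left' (by simpa using hpq.lt.le)

theorem lintegral_tail_le_of_bounded {C : ℝ} (hC : ∀ s ∈ Ioo (0 : ℝ) 1, rightDeriv δ s ≤ C)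
    {Y : Ω → ℝ} (hY : AEMeasurable Y P) :
    ∫⁻ t in Ioi (0 : ℝ), ENNReal.ofReal (δ (P.real {ω | t ≤ |Y ω|})) ≤
      ENNReal.ofReal C * ∫⁻ ω, ENNReal.ofReal |Y ω| ∂P := by
  rw [lintegral_eq_lintegral_meas_le P (.of_forall fun ω => abs_nonneg (Y ω)) hY.abs,
    ← lintegral_const_mul' _ _ ENNReal.ofReal_ne_top]
  refine lintegral_mono fun t => ?_
  have hG : P.real {ω | t ≤ |Y ω|} ∈ Icc (0 : ℝ) 1 := ⟨measureReal_nonneg, measureReal_le_one⟩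
  calc ENNReal.ofReal (δ (P.real {ω | t ≤ |Y ω|}))
      ≤ ∫⁻ s in Ioo 0 (P.real {ω | t ≤ |Y ω|}), ENNReal.ofReal (rightDeriv δ s) :=
        hδ.ofReal_le_lintegral_rightDeriv hG
    _ ≤ ∫⁻ _ in Ioo 0 (P.real {ω | t ≤ |Y ω|}), ENNReal.ofReal C :=
        setLIntegral_mono' measurableSet_Ioo fun s hs =>
          ENNReal.ofReal_le_ofReal (hC s ⟨hs.1, hs.2.trans_le hG.2⟩)
    _ = _ := by rw [setLIntegral_const, Real.volume_Ioo, sub_zero, ofReal_measureReal]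

/-- A uniform bound on the distorted tails over the unit ball of `L^p` puts the unit ball around a
large constant into the closure of the acceptance set, because simple functions are dense. -/
theorem interior_nonempty_of_tail_le {p : ℝ≥0∞} [Fact (1 ≤ p)] (hp : p ≠ ∞) {K : ℝ≥0∞}
    (hK : K ≠ ∞)
    (h : ∀ Y : Ω → ℝ, AEStronglyMeasurable Y P → eLpNorm Y p P ≤ 1 →
      ∫⁻ t in Ioi (0 : ℝ), ENNReal.ofReal (δ (P.real {ω | t ≤ |Y ω|})) ≤ K) :
    (interior (closureLp p (acceptanceSet P δ))).Nonempty := by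
  let f₀ : Lp ℝ p P := (memLp_const K.toReal).toLp
  have hf₀ : f₀ =ᵐ[P] fun _ => K.toReal := MemLp.coeFn_toLp _
  refine ⟨f₀, mem_interior.2 ⟨Metric.ball f₀ 1, ?_,
    Metric.isOpen_ball, Metric.mem_ball_self one_pos⟩⟩
  have hdense : Dense (range ((↑) : Lp.simpleFunc ℝ p P → Lp ℝ p P)) :=
    Lp.simpleFunc.denseRange hp
  refine (hdense.open_subset_closure_inter Metric.isOpen_ball).trans (closure_mono ?_)
  rintro _ ⟨hball, s, rfl⟩
  have hs := Lp.simpleFunc.toSimpleFunc_eq_toFun s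
  have hmem : MemLp (Lp.simpleFunc.toSimpleFunc s) ∞ P := SimpleFunc.memLp_top _ P
  let X : Lp ℝ ∞ P := hmem.toLp
  have hX : X =ᵐ[P] (s : Lp ℝ p P) := hmem.coeFn_toLp.trans hs
  refine ⟨X, hδ.mem_acceptanceSet_of_lintegral_le _ (c := K.toReal) ENNReal.toReal_nonneg ?_,
    hX.symm⟩
  rw [ENNReal.ofReal_toReal hK]
  refine h _ ((Lp.aestronglyMeasurable _).sub aestronglyMeasurable_const) ?_
  rw [Metric.mem_ball, dist_eq_norm, Lp.norm_def] at hball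
  have hcongr : (fun ω => X ω - K.toReal) =ᵐ[P] ((s : Lp ℝ p P) - f₀ : Lp ℝ p P) := by
    filter_upwards [hX, hf₀, Lp.coeFn_sub (s : Lp ℝ p P) f₀] with ω h1 h2 h3
    rw [h1, h3, Pi.sub_apply, h2]
  rw [eLpNorm_congr_ae hcongr, ← ENNReal.ofReal_toReal (Lp.eLpNorm_ne_top _)]
  simpa using hball.le

end IsConcaveDistortion

end Risk

/-! ### Dominated densities and the necessary condition -/

section Density

variable {Ω : Type*} [MeasurableSpace Ω] {P : Measure Ω} [IsProbabilityMeasure P] {δ : ℝ → ℝ}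

/-- `W` is a bounded density, with respect to `P`, of a probability measure `Q` such that
`Q B ≤ δ (P B)` for all events `B`. -/
structure IsDominatedDensity (P : Measure Ω) (δ : ℝ → ℝ) (W : Ω → ℝ) : Prop where
  measurable : Measurable W
  nonneg : ∀ ω, 0 ≤ W ω
  exists_le : ∃ C, ∀ ω, W ω ≤ C
  integral_eq_one : ∫ ω, W ω ∂P = 1
  setIntegral_le : ∀ B, MeasurableSet B → ∫ ω in B, W ω ∂P ≤ δ (P.real B)

namespace IsDominatedDensity

variable {W : Ω → ℝ} (hW : IsDominatedDensity P δ W)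
include hW

omit [IsProbabilityMeasure P] in
theorem integrable_mul {f : Ω → ℝ} (hf : Integrable f P) : Integrable (fun ω => W ω * f ω) P := by
  obtain ⟨C, hC⟩ := hW.exists_le
  refine hf.bdd_mul (c := C) hW.measurable.aestronglyMeasurable (.of_forall fun ω => ?_)
  rw [Real.norm_of_nonneg (hW.nonneg ω)]
  exact hC ω

theorem integrable : Integrable W P := by
  obtain ⟨C, hC⟩ := hW.exists_le
  exact .of_bound hW.measurable.aestronglyMeasurable C (.of_forall fun ω => by
    rw [Real.norm_of_nonneg (hW.nonneg ω)]; exact hC ω)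

/-- The easy half of the robust representation of `ρ_δ`: the expectation of `-X` under a measure
dominated by `δ ∘ P` is at most `ρ_δ(X)`. -/
theorem integral_mul_nonneg (hδ : IsConcaveDistortion δ) {X : Lp ℝ ∞ P}
    (hX : X ∈ acceptanceSet P δ) : 0 ≤ ∫ ω, W ω * X ω ∂P := by
  obtain ⟨c, hc0, hc⟩ := exists_ae_abs_le X
  have hXc : ∀ᵐ ω ∂P, X ω ≤ c := hc.mono fun ω h => (le_abs_self _).trans h
  have hXm : Measurable X := (Lp.stronglyMeasurable X).measurable
  have hXi : Integrable X P := (Lp.memLp X).integrable le_top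
  have hQ : ∀ B, MeasurableSet B →
      (P.withDensity fun ω => ENNReal.ofReal (W ω)).real B ≤ δ (P.real B) := by
    intro B hB
    rw [measureReal_def, withDensity_apply _ hB, ← integral_eq_lintegral_of_nonneg_ae
      (.of_forall hW.nonneg) hW.measurable.aestronglyMeasurable]
    exact hW.setIntegral_le B hB
  set Q := P.withDensity fun ω => ENNReal.ofReal (W ω) with hQdef
  have hQP : Q ≪ P := withDensity_absolutelyContinuous _ _
  have hQint : ∀ f : Ω → ℝ, ∫ ω, f ω ∂Q = ∫ ω, W ω * f ω ∂P := fun f => by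
    rw [hQdef, integral_withDensity_eq_integral_toReal_smul hW.measurable.ennreal_ofReal
      (.of_forall fun _ => ENNReal.ofReal_lt_top)]
    simp [ENNReal.toReal_ofReal (hW.nonneg _)]
  have : IsFiniteMeasure Q := isFiniteMeasure_withDensity_ofReal hW.integrable.2
  have hci : Integrable (fun ω => c - X ω) Q := by
    refine .of_bound (measurable_const.sub hXm).aestronglyMeasurable (c + c) ?_
    filter_upwards [hQP.ae_le hc] with ω hω
    rw [Real.norm_eq_abs]
    refine (abs_sub _ _).trans ?_
    rw [abs_of_nonneg hc0]
    gcongr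
  have h1 : ∫ ω, W ω * (c - X ω) ∂P ≤ c := by
    rw [← hQint, hci.integral_eq_integral_meas_le (hQP.ae_le (hXc.mono fun ω h => sub_nonneg.2 h))]
    have h2 := hδ.distortionRisk_eq X hc0 hXc
    have h3 : distortionRisk δ X ≤ 0 := hX
    rw [integral_Ici_eq_integral_Ioi] at h2
    refine le_trans (integral_mono_of_nonneg (.of_forall fun t => measureReal_nonneg)
      ((hδ.integrableOn_tail X c).1.mono_set Ioi_subset_Ici_self) (.of_forall fun t => ?_))
      (by linarith : _ ≤ c)
    exact hQ _ (measurableSet_le measurable_const (measurable_const.sub hXm))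
  simp only [mul_sub] at h1
  rw [integral_sub (hW.integrable.mul_const c) (hW.integrable_mul hXi), integral_mul_const,
    hW.integral_eq_one] at h1
  linarith

theorem continuous_integral_mul (p : ℝ≥0∞) [hp : Fact (1 ≤ p)] :
    Continuous fun f : Lp ℝ p P => ∫ ω, W ω * f ω ∂P := by
  obtain ⟨C, hC⟩ := hW.exists_le
  have hi : ∀ f : Lp ℝ p P, Integrable f P := fun f => (Lp.memLp f).integrable hp.out
  have hC0 : 0 ≤ C := by
    obtain ⟨ω⟩ : Nonempty Ω := nonempty_of_isProbabilityMeasure P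
    exact (hW.nonneg ω).trans (hC ω)
  refine (LipschitzWith.of_dist_le_mul (K := C.toNNReal) fun f g => ?_).continuous
  rw [Real.dist_eq, ← integral_sub (hW.integrable_mul (hi f)) (hW.integrable_mul (hi g)),
    Real.coe_toNNReal C hC0, Lp.dist_def]
  calc |∫ ω, (W ω * f ω - W ω * g ω) ∂P|
      ≤ ∫ ω, C * ‖(f - g : Ω → ℝ) ω‖ ∂P := by
        rw [← Real.norm_eq_abs]
        refine norm_integral_le_of_norm_le (((hi f).sub (hi g)).norm.const_mul C)
          (.of_forall fun ω => ?_)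
        rw [← mul_sub, norm_mul, Real.norm_of_nonneg (hW.nonneg ω)]
        exact mul_le_mul_of_nonneg_right (hC ω) (norm_nonneg _)
    _ = C * (eLpNorm (f - g : Ω → ℝ) 1 P).toReal := by
        rw [integral_const_mul, integral_norm_eq_lintegral_enorm ((hi f).sub (hi g)).1,
          eLpNorm_one_eq_lintegral_enorm]
    _ ≤ _ := by
        gcongr
        · exact ((Lp.memLp f).sub (Lp.memLp g)).eLpNorm_ne_top
        · exact eLpNorm_le_eLpNorm_of_exponent_le hp.out ((hi f).sub (hi g)).1

theorem integral_mul_nonneg_of_mem_closureLp (hδ : IsConcaveDistortion δ) {p : ℝ≥0∞}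
    [Fact (1 ≤ p)] {f : Lp ℝ p P} (hf : f ∈ closureLp p (acceptanceSet P δ)) :
    0 ≤ ∫ ω, W ω * f ω ∂P := by
  refine closure_minimal ?_ (isClosed_le continuous_const (hW.continuous_integral_mul p)) hf
  rintro f ⟨X, hX, hfX⟩
  refine (hW.integral_mul_nonneg hδ hX).trans_eq (integral_congr_ae ?_)
  filter_upwards [hfX] with ω h
  rw [h]

end IsDominatedDensity

/-- If the closure of the acceptance set has interior points in `L^p`, then the dominated densities
act on a ball of `L^p` with a common bound. The interior meets the acceptance set itself, in a
point that is bounded. -/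
theorem IsConcaveDistortion.exists_bound_of_interior_nonempty (hδ : IsConcaveDistortion δ)
    {p : ℝ≥0∞} [hp : Fact (1 ≤ p)]
    (hne : (interior (closureLp p (acceptanceSet P δ))).Nonempty) :
    ∃ M r : ℝ, 0 ≤ M ∧ 0 < r ∧ ∀ W, IsDominatedDensity P δ W → ∀ h : Ω → ℝ,
      AEStronglyMeasurable h P → eLpNorm h p P ≤ ENNReal.ofReal r → ∫ ω, W ω * h ω ∂P ≤ M := by
  obtain ⟨f₁, hf₁⟩ := hne
  obtain ⟨f₀, hf₀, X, -, hX⟩ := mem_closure_iff.1 (interior_subset hf₁) _ isOpen_interior hf₁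
  obtain ⟨R, hR, hball⟩ := Metric.isOpen_iff.1 isOpen_interior f₀ hf₀
  obtain ⟨M, hM0, hM⟩ := exists_ae_abs_le X
  refine ⟨M, R / 2, hM0, half_pos hR, fun W hW h hh hnorm => ?_⟩
  have hmem : MemLp h p P := ⟨hh, hnorm.trans_lt ENNReal.ofReal_lt_top⟩
  have hsub : f₀ - hmem.toLp ∈ closureLp p (acceptanceSet P δ) := by
    refine interior_subset (hball ?_)
    rw [Metric.mem_ball, dist_eq_norm, sub_sub_cancel_left, norm_neg, Lp.norm_toLp]
    exact (ENNReal.toReal_le_of_le_ofReal (half_pos hR).le hnorm).trans_lt (half_lt_self hR)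
  have h0 := hW.integral_mul_nonneg_of_mem_closureLp hδ hsub
  have hhi : Integrable h P := hmem.integrable hp.out
  have hXi : Integrable X P := (Lp.memLp X).integrable le_top
  have heq : ∫ ω, W ω * (f₀ - hmem.toLp : Lp ℝ p P) ω ∂P =
      ∫ ω, (W ω * X ω - W ω * h ω) ∂P := by
    refine integral_congr_ae ?_
    filter_upwards [Lp.coeFn_sub f₀ hmem.toLp, hX, hmem.coeFn_toLp] with ω h1 h2 h3
    rw [h1, Pi.sub_apply, h2, h3, mul_sub]
  rw [heq, integral_sub (hW.integrable_mul hXi) (hW.integrable_mul hhi)] at h0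
  have hXM : ∫ ω, W ω * X ω ∂P ≤ ∫ ω, W ω * M ∂P := by
    refine integral_mono_ae (hW.integrable_mul hXi) (hW.integrable.mul_const M) ?_
    filter_upwards [hM] with ω h
    exact mul_le_mul_of_nonneg_left ((le_abs_self _).trans h) (hW.nonneg ω)
  rw [integral_mul_const, hW.integral_eq_one, one_mul] at hXM
  linarith

namespace IsConcaveDistortion

variable (hδ : IsConcaveDistortion δ) {U : Ω → ℝ} (hU : Measurable U)
  (hmap : P.map U = volume.restrict (Ioc 0 1))

omit [IsProbabilityMeasure P] in
theorem integral_comp_uniform (hU : Measurable U) (hmap : P.map U = volume.restrict (Ioc 0 1))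
    {w : ℝ → ℝ} (hw : Measurable w) {b : ℝ} (hb : b ≤ 1) :
    ∫ ω in {ω | U ω ≤ b}, w (U ω) ∂P = ∫ t in Ioc 0 b, w t := by
  have h := setIntegral_map (μ := P) (g := U) (f := w) (s := Iic b) measurableSet_Iic
    hw.aestronglyMeasurable hU.aemeasurable
  rw [hmap, Measure.restrict_restrict measurableSet_Iic, Iic_inter_Ioc_of_le hb] at h
  exact h.symm

include hδ hU hmap

/-- A density that is a decreasing function of a uniform variable `U` gives its largest mass to an
event of given probability `b` when that event is `{U ≤ b}`. -/
theorem isDominatedDensity {ε : ℝ} (hε : ε ∈ Ioo (0 : ℝ) 1) :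
    IsDominatedDensity P δ fun ω => truncDeriv δ ε (U ω) := by
  set w := truncDeriv δ ε with hw
  have hwm : Measurable w := hδ.measurable_truncDeriv hε
  have hWi : Integrable (fun ω => w (U ω)) P :=
    .of_bound (hwm.comp hU).aestronglyMeasurable (δ ε / ε) (.of_forall fun ω => by
      rw [Real.norm_of_nonneg (hδ.truncDeriv_nonneg hε _)]; exact hδ.truncDeriv_le hε _)
  refine ⟨hwm.comp hU, fun ω => hδ.truncDeriv_nonneg hε _, ⟨_, fun ω => hδ.truncDeriv_le hε _⟩,
    ?_, fun B hB => ?_⟩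
  · rw [← integral_map (f := w) hU.aemeasurable hwm.aestronglyMeasurable, hmap,
      hδ.integral_truncDeriv_of_ge hε hε.2.le le_rfl, hδ.map_one]
  · have hb : P.real B ∈ Icc (0 : ℝ) 1 := ⟨measureReal_nonneg, measureReal_le_one⟩
    set b := P.real B with hbdef
    have hLm : MeasurableSet {ω | U ω ≤ b} := measurableSet_le hU measurable_const
    have hL : P.real {ω | U ω ≤ b} = b := by
      have := integral_comp_uniform hU hmap (w := fun _ => 1) measurable_const hb.2
      simpa [hb.1] using this
    have hci : Integrable (fun ω => w (U ω) - w b) P := hWi.sub (integrable_const _)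
    have key : ∫ ω in B, (w (U ω) - w b) ∂P ≤ ∫ ω in {ω | U ω ≤ b}, (w (U ω) - w b) ∂P := by
      rw [← integral_indicator hB, ← integral_indicator hLm]
      refine integral_mono (hci.indicator hB) (hci.indicator hLm) fun ω => ?_
      rcases le_or_gt (U ω) b with h | h
      · have h0 : 0 ≤ w (U ω) - w b := sub_nonneg.2 (hδ.truncDeriv_antitone hε h)
        rw [indicator_of_mem (show ω ∈ {ω | U ω ≤ b} from h)]
        exact indicator_le_self' (fun _ _ => h0) ω
      · have h0 : w (U ω) - w b ≤ 0 := sub_nonpos.2 (hδ.truncDeriv_antitone hε h.le)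
        rw [indicator_of_notMem (show ω ∉ {ω | U ω ≤ b} from not_le.2 h)]
        exact indicator_nonpos (fun _ _ => h0) ω
    rw [integral_sub hWi.integrableOn (by simp), integral_sub hWi.integrableOn (by simp),
      integral_comp_uniform hU hmap hwm hb.2, setIntegral_const, setIntegral_const, hL,
      ← hbdef] at key
    exact (sub_le_sub_iff_right _).1 key |>.trans (hδ.integral_truncDeriv_le hε hb)

theorem finitePower_top_of_interior_nonempty
    (hne : (interior (closureLp 1 (acceptanceSet P δ))).Nonempty) : FinitePower δ ∞ := by
  obtain ⟨M, r, -, hr, hM⟩ := hδ.exists_bound_of_interior_nonempty hne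
  refine .inr ⟨rfl, M / r, fun ε hε => (hδ.rightDeriv_le_div hε).trans ?_⟩
  have hLm : MeasurableSet {ω | U ω ≤ ε} := measurableSet_le hU measurable_const
  have hL : P {ω | U ω ≤ ε} = ENNReal.ofReal ε := by
    have h := Measure.map_apply (μ := P) hU (measurableSet_Iic (a := ε))
    rw [hmap, Measure.restrict_apply measurableSet_Iic, Iic_inter_Ioc_of_le hε.2.le,
      Real.volume_Ioc, sub_zero] at h
    exact h.symm
  -- the test function is a multiple of the indicator of the event on which the density is largest
  have h := hM _ (hδ.isDominatedDensity hU hmap hε) ({ω | U ω ≤ ε}.indicator fun _ => r / ε)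
    (aestronglyMeasurable_const.indicator hLm) (by
      rw [eLpNorm_indicator_const hLm one_ne_zero ENNReal.one_ne_top, hL,
        Real.enorm_eq_ofReal (div_pos hr hε.1).le]
      simp only [ENNReal.toReal_one, div_one, ENNReal.rpow_one]
      rw [← ENNReal.ofReal_mul (div_pos hr hε.1).le, div_mul_cancel₀ _ hε.1.ne'])
  have heq : ∫ ω, truncDeriv δ ε (U ω) * ({ω | U ω ≤ ε}.indicator fun _ => r / ε) ω ∂P =
      δ ε * (r / ε) := by
    have hind : ∀ ω, truncDeriv δ ε (U ω) * ({ω | U ω ≤ ε}.indicator fun _ => r / ε) ω =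
        {ω | U ω ≤ ε}.indicator (fun ω => truncDeriv δ ε (U ω) * (r / ε)) ω :=
      fun ω => (indicator_mul_right _ (fun ω => truncDeriv δ ε (U ω)) _).symm
    rw [integral_congr_ae (.of_forall hind), integral_indicator hLm, integral_mul_const,
      integral_comp_uniform hU hmap (hδ.measurable_truncDeriv hε) hε.2.le,
      hδ.integral_truncDeriv_of_ge hε le_rfl hε.2.le]
  rw [heq] at h
  rw [le_div_iff₀ hr]
  calc δ ε / ε * r = δ ε * (r / ε) := by ring
    _ ≤ M := h

theorem lintegral_rightDeriv_rpow_lt_top {p q : ℝ} (hpq : p.HolderConjugate q)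
    [Fact (1 ≤ ENNReal.ofReal p)]
    (hne : (interior (closureLp (ENNReal.ofReal p) (acceptanceSet P δ))).Nonempty) :
    ∫⁻ t in Ioo (0 : ℝ) 1, ENNReal.ofReal (rightDeriv δ t) ^ q < ∞ := by
  obtain ⟨M, r, hM0, hr, hM⟩ := hδ.exists_bound_of_interior_nonempty hne
  have hq0 : 0 < q := hpq.symm.pos
  have hbound : ∀ ε ∈ Ioo (0 : ℝ) 1, ∫⁻ t in Ioo ε 1, ENNReal.ofReal (rightDeriv δ t) ^ q ≤
      ENNReal.ofReal (max 1 ((M / r) ^ q)) := by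
    intro ε hε
    have hW := hδ.isDominatedDensity hU hmap hε
    set W : Ω → ℝ := fun ω => truncDeriv δ ε (U ω) with hWdef
    have hWq : Integrable (fun ω => W ω ^ q) P := by
      refine .of_bound (hW.measurable.pow_const q).aestronglyMeasurable ((δ ε / ε) ^ q)
        (.of_forall fun ω => ?_)
      rw [Real.norm_of_nonneg (Real.rpow_nonneg (hW.nonneg ω) _)]
      exact Real.rpow_le_rpow (hW.nonneg ω) (hδ.truncDeriv_le hε _) hq0.le
    set N := ∫ ω, W ω ^ q ∂P with hN
    have hofN : ENNReal.ofReal N = ∫⁻ ω, ENNReal.ofReal (W ω ^ q) ∂P :=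
      ofReal_integral_eq_lintegral_ofReal hWq
        (.of_forall fun ω => Real.rpow_nonneg (hW.nonneg ω) _)
    have hle : ∫⁻ t in Ioo ε 1, ENNReal.ofReal (rightDeriv δ t) ^ q ≤ ENNReal.ofReal N := by
      have hm : Measurable fun t => ENNReal.ofReal (truncDeriv δ ε t ^ q) :=
        ((hδ.measurable_truncDeriv hε).pow_const q).ennreal_ofReal
      rw [hofN, ← lintegral_map (f := fun t => ENNReal.ofReal (truncDeriv δ ε t ^ q)) hm hU, hmap]
      refine le_trans (setLIntegral_mono' measurableSet_Ioo fun t ht => ?_)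
        (lintegral_mono_set (Ioo_subset_Ioc_self.trans (Ioc_subset_Ioc_left hε.1.le)))
      have h0 : 0 ≤ rightDeriv δ t := hδ.rightDeriv_nonneg ⟨hε.1.trans ht.1, ht.2⟩
      rw [ENNReal.ofReal_rpow_of_nonneg h0 hq0.le]
      simp [truncDeriv, not_le.2 ht.1, ht.2]
    refine hle.trans (ENNReal.ofReal_le_ofReal ?_)
    rcases le_or_gt N 1 with hN1 | hN1
    · exact hN1.trans (le_max_left _ _)
    refine le_max_of_le_right ?_
    have hN0 : 0 < N := one_pos.trans hN1
    -- the test function that is extremal in Hölder's inequality, scaled to norm `r`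
    set s := r * N ^ (-(1 / p)) with hs
    have hs0 : 0 < s := mul_pos hr (Real.rpow_pos_of_pos hN0 _)
    have hsp : s ^ p * N = r ^ p := by
      rw [hs, Real.mul_rpow hr.le (Real.rpow_nonneg hN0.le _), ← Real.rpow_mul hN0.le,
        neg_mul, one_div_mul_cancel hpq.ne_zero, Real.rpow_neg_one, mul_assoc,
        inv_mul_cancel₀ hN0.ne', mul_one]
    have hexp : (q - 1) * p = q := by linarith [hpq.mul_eq_add]
    have h := hM W hW (fun ω => s * W ω ^ (q - 1))
      ((hW.measurable.pow_const _).const_mul s).aestronglyMeasurable (by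
        have hp0 : ENNReal.ofReal p ≠ 0 := by simpa using hpq.pos
        rw [eLpNorm_eq_lintegral_rpow_enorm_toReal hp0 ENNReal.ofReal_ne_top,
          ENNReal.toReal_ofReal hpq.nonneg, one_div, ENNReal.rpow_inv_le_iff hpq.pos,
          ENNReal.ofReal_rpow_of_nonneg hr.le hpq.nonneg, ← hsp,
          ENNReal.ofReal_mul (Real.rpow_nonneg hs0.le _), hofN,
          ← lintegral_const_mul' _ _ ENNReal.ofReal_ne_top]
        refine lintegral_mono fun ω => ?_
        have h1 : 0 ≤ W ω ^ (q - 1) := Real.rpow_nonneg (hW.nonneg ω) _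
        rw [Real.enorm_eq_ofReal (mul_nonneg hs0.le h1),
          ENNReal.ofReal_rpow_of_nonneg (mul_nonneg hs0.le h1) hpq.nonneg,
          Real.mul_rpow hs0.le h1, ← Real.rpow_mul (hW.nonneg ω), hexp,
          ENNReal.ofReal_mul (Real.rpow_nonneg hs0.le _)])
    have heq : ∫ ω, W ω * (s * W ω ^ (q - 1)) ∂P = s * N := by
      rw [hN, ← integral_const_mul]
      refine integral_congr_ae (.of_forall fun ω => ?_)
      have : W ω * W ω ^ (q - 1) = W ω ^ q := by
        rw [← Real.rpow_one_add' (hW.nonneg ω) (by simpa using hq0.ne'), add_sub_cancel]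
      simp only
      rw [← this]
      ring
    rw [heq, hs, mul_assoc, ← Real.rpow_add_one hN0.ne', show -(1 / p) + 1 = q⁻¹ by
      have := hpq.inv_add_inv_eq_one
      rw [one_div]
      linarith] at h
    rw [← Real.rpow_inv_le_iff_of_pos hN0.le (by positivity) hq0, le_div_iff₀ hr, mul_comm]
    exact h
  have hU' : Ioo (0 : ℝ) 1 = ⋃ n : ℕ, Ioo (1 / ((n : ℝ) + 2)) 1 := by
    ext t
    simp only [mem_Ioo, mem_iUnion]
    constructor
    · rintro ⟨h0, h1⟩
      obtain ⟨n, hn⟩ := exists_nat_one_div_lt h0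
      exact ⟨n, (one_div_le_one_div_of_le (by positivity) (by linarith)).trans_lt hn, h1⟩
    · rintro ⟨n, hn, h1⟩
      exact ⟨lt_trans (by positivity) hn, h1⟩
  refine lt_of_le_of_lt ?_ (ENNReal.ofReal_lt_top (r := max 1 ((M / r) ^ q)))
  rw [hU', setLIntegral_iUnion_of_directed _ (Monotone.directed_le fun m n hmn =>
    Ioo_subset_Ioo_left (one_div_le_one_div_of_le (by positivity) (by gcongr)))]
  exact iSup_le fun n => hbound _ ⟨by positivity, by
    rw [div_lt_one (by positivity)]; linarith [(n.cast_nonneg : (0 : ℝ) ≤ n)]⟩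

end IsConcaveDistortion

end Density

/-! ### The index of finiteness -/

theorem finitePower_iff_of_ne_top {δ : ℝ → ℝ} {p : ℝ≥0∞} (hp : p ≠ ∞) : FinitePower δ p ↔
    ∫⁻ t in Ioo (0 : ℝ) 1, ENNReal.ofReal (rightDeriv δ t) ^ p.toReal < ∞ := by
  simp [FinitePower, hp]

theorem FinitePower.mono {δ : ℝ → ℝ} {r s : ℝ≥0∞} (h : FinitePower δ r) (hs : s ≠ ∞)
    (hsr : s ≤ r) : FinitePower δ s := by
  rw [finitePower_iff_of_ne_top hs]
  have h1 : ∫⁻ _ in Ioo (0 : ℝ) 1, (1 : ℝ≥0∞) < ∞ := by simp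
  rcases h with ⟨hr, h⟩ | ⟨-, C, hC⟩
  · refine lt_of_le_of_lt (lintegral_mono fun t => ?_)
      ((lintegral_add_left measurable_const _).trans_lt (ENNReal.add_lt_top.2 ⟨h1, h⟩))
    rcases le_total (ENNReal.ofReal (rightDeriv δ t)) 1 with hg | hg
    · exact le_add_right (ENNReal.rpow_le_one hg ENNReal.toReal_nonneg)
    · exact le_add_left (ENNReal.rpow_le_rpow_of_exponent_le hg (ENNReal.toReal_mono hr hsr))
  · calc ∫⁻ t in Ioo (0 : ℝ) 1, ENNReal.ofReal (rightDeriv δ t) ^ s.toReal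
        ≤ ∫⁻ _ in Ioo (0 : ℝ) 1, ENNReal.ofReal C ^ s.toReal :=
          setLIntegral_mono' measurableSet_Ioo fun t ht => by
            gcongr
            exact hC t ht
      _ < ∞ := by
          rw [setLIntegral_const]
          exact ENNReal.mul_lt_top (ENNReal.rpow_lt_top_of_nonneg ENNReal.toReal_nonneg
            ENNReal.ofReal_ne_top) (by simp)

section Index

variable {Ω : Type*} [MeasurableSpace Ω] {P : Measure Ω} [IsProbabilityMeasure P] {δ : ℝ → ℝ}

/-- The exponent `p` is admissible exactly if `δ'_+` lies in the dual space of `L^p`. -/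
theorem interior_nonempty_iff (hP : Nonatomic P) (hδ : IsConcaveDistortion δ) {p : ℝ≥0∞}
    [hp1 : Fact (1 ≤ p)] (hp : p ≠ ∞) :
    (interior (closureLp p (acceptanceSet P δ))).Nonempty ↔
      FinitePower δ (ENNReal.conjExponent p) := by
  obtain ⟨U, hU, hmap⟩ := hP.exists_uniform
  rcases hp1.out.eq_or_lt with rfl | hlt
  · rw [show ENNReal.conjExponent 1 = ∞ by simp [ENNReal.conjExponent]]
    refine ⟨hδ.finitePower_top_of_interior_nonempty hU hmap, ?_⟩
    rintro (⟨h, -⟩ | ⟨-, C, hC⟩)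
    · exact absurd rfl h
    refine hδ.interior_nonempty_of_tail_le hp (ENNReal.ofReal_ne_top (r := C)) fun Y hY hn => ?_
    refine (hδ.lintegral_tail_le_of_bounded hC hY.aemeasurable).trans (mul_le_of_le_one_right' ?_)
    rw [eLpNorm_one_eq_lintegral_enorm] at hn
    simpa only [Real.enorm_eq_ofReal_abs] using hn
  · have hq : ENNReal.conjExponent p ≠ ∞ := by
      simp [ENNReal.conjExponent, tsub_eq_zero_iff_le, hlt]
    have hpq : p.toReal.HolderConjugate (ENNReal.conjExponent p).toReal :=
      ENNReal.HolderConjugate.toReal_of_ne_top hp hq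
    rw [finitePower_iff_of_ne_top hq]
    constructor
    · intro hne
      have hpr := ENNReal.ofReal_toReal hp
      have : Fact (1 ≤ ENNReal.ofReal p.toReal) := by rwa [hpr]
      refine hδ.lintegral_rightDeriv_rpow_lt_top hU hmap hpq ?_
      convert! hne
    · intro h
      refine hδ.interior_nonempty_of_tail_le hp (ENNReal.add_ne_top.2 ⟨h.ne, ENNReal.one_ne_top⟩)
        fun Y hY hn => (hδ.lintegral_tail_le hpq hY.aemeasurable).trans ?_
      gcongr
      rw [eLpNorm_eq_lintegral_rpow_enorm_toReal (one_pos.trans hlt).ne' hp, one_div,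
        ENNReal.rpow_inv_le_iff hpq.pos, ENNReal.one_rpow] at hn
      refine le_trans (lintegral_mono fun ω => ?_) hn
      rw [Real.enorm_eq_ofReal_abs, ENNReal.ofReal_rpow_of_nonneg (abs_nonneg _) hpq.nonneg]

theorem mem_finitenessExponents_iff (hP : Nonatomic P) (hδ : IsConcaveDistortion δ) {p : ℝ≥0∞} :
    p ∈ finitenessExponents (acceptanceSet P δ) ↔
      p ≠ ∞ ∧ 1 ≤ p ∧ FinitePower δ (ENNReal.conjExponent p) := by
  refine and_congr_right fun hp => ⟨?_, ?_⟩
  · rintro ⟨h1, h⟩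
    exact ⟨h1.out, (interior_nonempty_iff hP hδ hp).1 h⟩
  · rintro ⟨h1, h⟩
    have h1' : Fact (1 ≤ p) := ⟨h1⟩
    exact ⟨h1', (interior_nonempty_iff hP hδ hp).2 h⟩

end Index

theorem conjExponent_conjExponent {p : ℝ≥0∞} (hp : 1 ≤ p) :
    ENNReal.conjExponent (ENNReal.conjExponent p) = p :=
  have := (ENNReal.HolderConjugate.conjExponent hp).symm
  ENNReal.HolderConjugate.conjExponent_eq

theorem one_le_conjExponent (p : ℝ≥0∞) : 1 ≤ ENNReal.conjExponent p :=
  le_add_right le_rfl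

theorem conjExponent_antitone : Antitone ENNReal.conjExponent := fun p q h => by
  unfold ENNReal.conjExponent
  gcongr

theorem one_lt_conjExponent {p : ℝ≥0∞} (hp : p ≠ ∞) : 1 < ENNReal.conjExponent p :=
  ENNReal.lt_add_right ENNReal.one_ne_top (ENNReal.inv_ne_zero.2 (ENNReal.sub_ne_top hp))

theorem conjExponent_ne_top_iff {p : ℝ≥0∞} : ENNReal.conjExponent p ≠ ∞ ↔ 1 < p := by
  simp [ENNReal.conjExponent, tsub_eq_zero_iff_le]

end DistortionRisk

theorem proposition8p2 {Ω : Type*} [MeasurableSpace Ω] (P : Measure Ω) [IsProbabilityMeasure P]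
    (hP : DistortionRisk.Nonatomic P)
    (δ : ℝ → ℝ) (hδ : DistortionRisk.IsConcaveDistortion δ)
    (S : DistortionRisk.TradedAsset P)
    (hfin : ∀ X : Lp ℝ ∞ P,
      DistortionRisk.riskMeasure (DistortionRisk.acceptanceSet P δ) S X ≠ ⊥ ∧
      DistortionRisk.riskMeasure (DistortionRisk.acceptanceSet P δ) S X ≠ ⊤) :
    DistortionRisk.indexOfFiniteness (DistortionRisk.acceptanceSet P δ) =
        ENNReal.conjExponent (DistortionRisk.criticalExponent δ) ∧
      (DistortionRisk.IndexAttained (DistortionRisk.acceptanceSet P δ) ↔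
        1 < DistortionRisk.criticalExponent δ ∧
          DistortionRisk.FinitePower δ (DistortionRisk.criticalExponent δ)) := by
  open DistortionRisk in
  set q := criticalExponent δ
  have hmem {p : ℝ≥0∞} := mem_finitenessExponents_iff hP hδ (p := p)
  have hindex : indexOfFiniteness (acceptanceSet P δ) = ENNReal.conjExponent q := by
    refine le_antisymm (le_of_forall_gt fun p hp => ?_) (le_sInf fun p hp => ?_)
    · obtain ⟨s, hs, hsp⟩ := exists_between hp
      have hs1 : 1 < s := (one_le_conjExponent q).trans_lt hs
      have hsq : ENNReal.conjExponent s < q := by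
        by_contra! h
        have := conjExponent_antitone h
        rw [conjExponent_conjExponent hs1.le] at this
        exact this.not_gt hs
      obtain ⟨r, ⟨-, -, hr⟩, hsr⟩ := lt_sSup_iff.1 hsq
      exact (sInf_le (hmem.2 ⟨hsp.ne_top, hs1.le,
        hr.mono (conjExponent_ne_top_iff.2 hs1) hsr.le⟩)).trans_lt hsp
    · obtain ⟨hp, hp1, h⟩ := hmem.1 hp
      suffices hle : ENNReal.conjExponent p ≤ q by
        have := conjExponent_antitone hle
        rwa [conjExponent_conjExponent hp1] at this
      refine le_of_forall_lt fun r hr => ?_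
      -- the supremum defining `q` runs over finite exponents, so `p' = ∞` has to be approached
      obtain ⟨s, hs, hsp⟩ := exists_between (max_lt hr (one_lt_conjExponent hp))
      exact ((le_max_left _ _).trans_lt hs).trans_le
        (le_sSup ⟨(le_max_right _ _).trans hs.le, hsp.ne_top, h.mono hsp.ne_top hsp.le⟩)
  refine ⟨hindex, ?_⟩
  rw [IndexAttained, hindex, hmem, conjExponent_ne_top_iff]
  refine and_congr_right fun h => ?_
  rw [conjExponent_conjExponent h.le]
  exact and_iff_right (one_le_conjExponent q)
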